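/- Let $(W,S)$ be a Coxeter system with $W$ finite, let $\ell_S$ be its length function, let $m_{s,t}$ be the order of $st$ in $W$ for $s,t\in S$, and let $\mathbf S=\{\mathbf s : s\in S\}$ be a set in bijection with $S$. Let $B^+(W)$ and $B(W)$ be the monoid and the group generated by $\mathbf S$ with the relations $\mathbf s\mathbf t\mathbf s\cdots=\mathbf t\mathbf s\mathbf t\cdots$ ($m_{s,t}$ factors on each side) for $s,t\in S$. Identify $B^+(W)$ with its image in $B(W)$, and for $u,v\in B(W)$ write $u\preccurlyeq v$ if $u^{-1}v\in B^+(W)$; this is a partial order on $B(W)$. For $w\in W$, the positive lift of $w$ is the element $\mathbf w=\mathbf s_1\cdots\mathbf s_k\in B(W)$, where $w=s_1\cdots s_k$ is a reduced expression, that is, $s_i\in S$ and $k=\ell_S(w)$; it does not depend on the choice of the expression. Let $\mathbf W=\{\mathbf w: w\in W\}$ be the set of simple braids, and let $\Delta=\mathbf w_0$ be the positive lift of the longest element $w_0$ of $W$. Let $\beta\in B(W)$. The following are equivalent: (1) $\beta$ is a rational permutation braid, that is, $\Delta^{-1}\preccurlyeq\beta\preccurlyeq\Delta$; (2) there exist $x,y\in\mathbf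 W$ such that $\beta=x^{-1}y$; (3) there exist $x,y\in\mathbf W$ such that $\beta=xy^{-1}$. -/

import Mathlib

namespace CoxeterSystem

variable {B W : Type*} [Group W] {M : CoxeterMatrix B} (cs : CoxeterSystem M W)

/-- The word `⋯ s_i s_j` with `m` letters, ending in `s_j`, where `m` is the order of
`s_i s_j` in `W`. It is the empty word if that order is infinite, as `orderOf` is then `0`. -/
noncomputable def braidSide (i j : B) : List B :=
  alternatingWord i j (orderOf (cs.simple i * cs.simple j))

/-- The defining relations of the braid monoid: for every pair of generators, the two alternating
words in them whose number of letters is the order of the product are equal.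
(Nothing is imposed when that order is infinite.) -/
inductive BraidRel : FreeMonoid B → FreeMonoid B → Prop
  | braid (i j : B) :
      BraidRel (FreeMonoid.ofList (cs.braidSide i j)) (FreeMonoid.ofList (cs.braidSide j i))

/-- The classical braid monoid (Artin-Tits monoid) `B⁺(W)`, by generators and relations. -/
abbrev BraidMonoid : Type _ := PresentedMonoid cs.BraidRel

/-- The braid relations, as a set of relators in the free group. -/
def braidRelators : Set (FreeGroup B) :=
  Set.range fun p : B × B =>
    ((cs.braidSide p.1 p.2).map FreeGroup.of).prod *
      (((cs.braidSide p.2 p.1).map FreeGroup.of).prod)⁻¹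

/-- The braid group (Artin-Tits group) `B(W)`: the group with the same presentation. -/
def BraidGroup : Type _ := PresentedGroup cs.braidRelators

noncomputable instance : Group cs.BraidGroup :=
  inferInstanceAs (Group (PresentedGroup cs.braidRelators))

/-- The generator of the braid group that lifts the simple reflection `s_i`. -/
def braidGen (i : B) : cs.BraidGroup := PresentedGroup.of (rels := cs.braidRelators) i

/-- The positive braid that is represented by a word. -/
noncomputable def braidProd (ω : List B) : cs.BraidGroup := (ω.map cs.braidGen).prod

theorem braidProd_braidSide (i j : B) :
    cs.braidProd (cs.braidSide i j) = cs.braidProd (cs.braidSide j i) := by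
  have key : ∀ ω : List B, cs.braidProd ω =
      PresentedGroup.mk cs.braidRelators ((ω.map FreeGroup.of).prod) := by
    intro ω
    rw [map_list_prod, List.map_map]
    rfl
  have h : PresentedGroup.mk cs.braidRelators (((cs.braidSide i j).map FreeGroup.of).prod *
      (((cs.braidSide j i).map FreeGroup.of).prod)⁻¹) = 1 :=
    PresentedGroup.one_of_mem ⟨(i, j), rfl⟩
  rw [map_mul, map_inv, ← key, ← key] at h
  exact mul_inv_eq_one.mp h

/-- The canonical homomorphism `B⁺(W) → B(W)`. -/
noncomputable def braidMonoidHom : cs.BraidMonoid →* cs.BraidGroup :=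
  PresentedMonoid.lift cs.braidGen (by
    rintro _ _ ⟨i, j⟩
    simpa [FreeMonoid.lift_apply, braidProd] using cs.braidProd_braidSide i j)

/-- `B⁺(W)` as a subset of `B(W)`. -/
noncomputable def positiveBraids : Submonoid cs.BraidGroup := MonoidHom.mrange cs.braidMonoidHom

theorem exists_braidProd_of_mem {β : cs.BraidGroup} (h : β ∈ cs.positiveBraids) :
    ∃ ω : List B, cs.braidProd ω = β := by
  obtain ⟨b, rfl⟩ := h
  obtain ⟨w, rfl⟩ := PresentedMonoid.surjective_mk b
  exact ⟨w.toList, (FreeMonoid.lift_apply cs.braidGen w).symm⟩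

theorem eq_nil_of_braidProd_mul_eq_one {ω ω' : List B}
    (h : cs.braidProd ω * cs.braidProd ω' = 1) : ω = [] := by
  let f : B → Multiplicative ℤ := fun _ => Multiplicative.ofAdd 1
  have hlen : ∀ ω : List B, FreeGroup.lift f ((ω.map FreeGroup.of).prod) =
      Multiplicative.ofAdd (ω.length : ℤ) := by
    intro ω
    induction ω with
    | nil => rfl
    | cons a t ih =>
      rw [List.map_cons, List.prod_cons, map_mul, ih, FreeGroup.lift_apply_of, ← ofAdd_add]
      congr 1
      push_cast [List.length_cons]
      ring
  have hside : ∀ i j, (cs.braidSide i j).length = (cs.braidSide j i).length := by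
    intro i j
    rw [braidSide, braidSide, length_alternatingWord, length_alternatingWord,
      ← orderOf_inv (cs.simple i * cs.simple j)]
    simp
  have hrel : ∀ r ∈ cs.braidRelators, FreeGroup.lift f r = 1 := by
    rintro _ ⟨⟨i, j⟩, rfl⟩
    simp only [map_mul, map_inv, hlen, hside i j, mul_inv_cancel]
  let d : cs.BraidGroup →* Multiplicative ℤ := PresentedGroup.toGroup hrel
  have hd : ∀ ω, d (cs.braidProd ω) = Multiplicative.ofAdd (ω.length : ℤ) := by
    intro ω
    rw [← hlen, braidProd, map_list_prod, map_list_prod, List.map_map, List.map_map]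
    congr 1
  have h1 := congrArg d h
  rw [map_mul, hd, hd, map_one, ← ofAdd_add, ofAdd_eq_one] at h1
  exact List.length_eq_zero_iff.mp (by omega)

/-- The prefix order on the braid group: `u ≤ v` if and only if `u⁻¹ v ∈ B⁺(W)`. -/
noncomputable instance : PartialOrder cs.BraidGroup where
  le u v := u⁻¹ * v ∈ cs.positiveBraids
  le_refl u := by simp [one_mem]
  le_trans u v w h h' := by simpa [mul_assoc] using mul_mem h h'
  le_antisymm u v h h' := by
    obtain ⟨ω, hω⟩ := cs.exists_braidProd_of_mem h
    obtain ⟨ω', hω'⟩ := cs.exists_braidProd_of_mem h'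
    have h0 : ω = [] := cs.eq_nil_of_braidProd_mul_eq_one (ω' := ω') (by
      rw [hω, hω']
      group)
    rw [h0, braidProd, List.map_nil, List.prod_nil] at hω
    exact inv_mul_eq_one.mp hω.symm

/-- `β` is the positive lift of `w`: the braid represented by a reduced word of `w`. -/
def IsPositiveLift (β : cs.BraidGroup) (w : W) : Prop :=
  ∃ ω : List B, cs.IsReduced ω ∧ cs.wordProd ω = w ∧ cs.braidProd ω = β

/-- The set of simple braids: the positive lifts of the elements of `W`. -/
def simpleBraids : Set cs.BraidGroup := {β | ∃ w : W, cs.IsPositiveLift β w}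

/-- `w₀` is the longest element of `W`. -/
def IsLongest (w₀ : W) : Prop := ∀ w : W, cs.length w ≤ cs.length w₀

/-- `Δ` is the Garside element of the braid monoid: the positive lift of the longest element. -/
def IsGarsideElement (Δ : cs.BraidGroup) : Prop :=
  ∃ w₀ : W, cs.IsLongest w₀ ∧ cs.IsPositiveLift Δ w₀

/-- When `W` is finite, there is a Garside element. -/
theorem exists_isGarsideElement [Finite W] : ∃ Δ : cs.BraidGroup, cs.IsGarsideElement Δ := by
  obtain ⟨w₀, hw₀⟩ := Finite.exists_max cs.length
  obtain ⟨ω, hω, h⟩ := cs.exists_isReduced w₀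
  exact ⟨_, w₀, hw₀, ω, hω, h.symm, rfl⟩

/-- The rational permutation braids: the interval `[Δ⁻¹, Δ]` of the prefix order. -/
def rationalPermutationBraids (Δ : cs.BraidGroup) : Set cs.BraidGroup := Set.Icc Δ⁻¹ Δ

end CoxeterSystem

namespace CoxeterSystem

variable {B W : Type*} [Group W] {M : CoxeterMatrix B} (cs : CoxeterSystem M W)

/-! ### The sign representation on reflections and the exchange property -/

/-! Write `a = Δβ` and `b = β⁻¹Δ`. Condition (1) says that both are positive, and `ab = Δ²`. If a
right divisor of a product of two simple elements of `B⁺(W)` is again such a product, then `b = xy`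
with `x`, `y` simple, whence `β = (Δy⁻¹)x⁻¹`, and `Δy⁻¹` is simple because every simple element
divides `Δ`. This is (3). Conjugation by `Δ` permutes the simple braids, which turns (3) into (2),
and the same two facts show that `x⁻¹y` lies in the interval.

The divisor statement (`eq_posLift_mul_posLift_of_mul_eq`) comes from greedy normal forms. `B⁺(W)`
acts on finite sequences in `W`: `w` absorbs the greatest prefix of the first term that multiplies
without cancellation, and the remainder is pushed to the right (`seqSMul`, `seqSMul_mul`). Each
simple factor lengthens a sequence by at most one term, and a sequence can be recovered, up to its
product, from its image under `w`. This gives the divisor statement and also left cancellation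
(`braidMonoid_mul_left_cancel`).

The equation `ab = Δ²` has to be read in the monoid, so `B⁺(W) → B(W)` must be injective: `Δ²` is
central, and left cancellation embeds `B⁺(W)` in its localization at the powers of `Δ²`, where the
generators are units.

The Coxeter theory underneath is the strong exchange property, dihedral suffixes, Matsumoto's
theorem and the existence of greatest prefixes. -/

theorem simple_mul_pow_mul_simple (i j : B) (q : ℕ) :
    cs.simple j * (cs.simple i * cs.simple j) ^ q * cs.simple j =
      ((cs.simple i * cs.simple j) ^ q)⁻¹ := by
  have h : (cs.simple i * cs.simple j)⁻¹ = cs.simple j * (cs.simple i * cs.simple j) *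
      (cs.simple j)⁻¹ := by simp [mul_assoc]
  rw [← inv_pow, h, conj_pow, inv_simple]

open scoped Classical in
/-- The action of the simple reflection `s_i` on pairs of an element of `W` and a sign:
it conjugates the element, and changes the sign if the element is `s_i`. -/
noncomputable def signFlip (i : B) : Function.End (W × ZMod 2) := fun p =>
  (cs.simple i * p.1 * cs.simple i, p.2 + if p.1 = cs.simple i then 1 else 0)

open scoped Classical in
theorem signFlip_mul_pow_apply (i j : B) (k : ℕ) (t : W) (e : ZMod 2) :
    ((cs.signFlip i * cs.signFlip j) ^ k) (t, e) =
      ((cs.simple i * cs.simple j) ^ k * t * ((cs.simple i * cs.simple j) ^ k)⁻¹,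
        e + ∑ q ∈ Finset.range (2 * k),
          if t = cs.simple j * (cs.simple i * cs.simple j) ^ q then 1 else 0) := by
  induction k with
  | zero => simp; rfl
  | succ k ih =>
    set x := cs.simple i * cs.simple j with hx
    have hxi : x⁻¹ = cs.simple j * cs.simple i := by simp [hx]
    have hconj := cs.simple_mul_pow_mul_simple i j k
    rw [← hx] at hconj
    have h0 : x ^ k * t * (x ^ k)⁻¹ = cs.simple j ↔ t = cs.simple j * x ^ (2 * k) := by
      rw [two_mul, pow_add, ← mul_assoc, mul_inv_eq_iff_eq_mul, ← eq_inv_mul_iff_mul_eq,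
        ← hconj]
      simp [mul_assoc]
    have h1 : cs.simple j * (x ^ k * t * (x ^ k)⁻¹) * cs.simple j = cs.simple i ↔
        t = cs.simple j * x ^ (2 * k + 1) := by
      have e1 : x ^ (2 * k + 1) = x ^ k * (x * x ^ k) := by
        rw [← pow_succ', ← pow_add]; congr 1; ring
      rw [e1]
      constructor
      · intro h
        have h2 : t = (x ^ k)⁻¹ * (cs.simple j * cs.simple i * cs.simple j) * x ^ k := by
          rw [← h]; simp [mul_assoc]
        rw [h2, ← hconj, hx]; simp [mul_assoc]
      · rintro rfl
        have h2 : cs.simple j * (x ^ k * (x * x ^ k)) =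
            (x ^ k)⁻¹ * (cs.simple j * x) * x ^ k := by
          rw [← hconj]; simp [mul_assoc]
        rw [h2, hx]; simp [mul_assoc]
    rw [pow_succ' _ k]
    change (cs.signFlip i * cs.signFlip j) (((cs.signFlip i * cs.signFlip j) ^ k) (t, e)) = _
    rw [ih]
    change cs.signFlip i (cs.signFlip j _) = _
    simp only [signFlip, h0, h1]
    rw [show 2 * (k + 1) = 2 * k + 1 + 1 by ring, Finset.sum_range_succ, Finset.sum_range_succ,
      pow_succ' x k, mul_inv_rev, hxi]
    ext
    · simp [hx, mul_assoc]
    · simp [add_assoc]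

theorem isLiftable_signFlip : M.IsLiftable cs.signFlip := by
  classical
  intro i j
  funext ⟨t, e⟩
  -- The exponents `q` and `m + q` give the same reflection, since `(s_i s_j)^m = 1`, so the two
  -- halves of the sum cancel modulo 2.
  rw [signFlip_mul_pow_apply, simple_mul_simple_pow, two_mul, Finset.sum_range_add]
  simp [pow_add, CharTwo.add_self_eq_zero]
  rfl

/-- The sign representation of `W`. -/
noncomputable def signRep : W →* Function.End (W × ZMod 2) :=
  cs.lift ⟨cs.signFlip, cs.isLiftable_signFlip⟩

/-- The sign of `t` under the action of `w`. -/
noncomputable def inversionSign (w t : W) : ZMod 2 := (cs.signRep w (t, 0)).2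

open scoped Classical in
theorem signRep_wordProd_apply (ω : List B) (t : W) (e : ZMod 2) :
    cs.signRep (cs.wordProd ω) (t, e) =
      (cs.wordProd ω * t * (cs.wordProd ω)⁻¹, e + ((cs.rightInvSeq ω).count t : ZMod 2)) := by
  induction ω with
  | nil => simp; rfl
  | cons i ω ih =>
    rw [wordProd_cons, map_mul]
    change cs.signRep (cs.simple i) (cs.signRep (cs.wordProd ω) (t, e)) = _
    rw [ih, signRep, lift_apply_simple, signFlip, rightInvSeq, List.count_cons]
    have h : cs.wordProd ω * t * (cs.wordProd ω)⁻¹ = cs.simple i ↔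
        (cs.wordProd ω)⁻¹ * cs.simple i * cs.wordProd ω = t := by
      rw [mul_inv_eq_iff_eq_mul, ← eq_inv_mul_iff_mul_eq, mul_assoc, eq_comm]
    simp only [h, beq_iff_eq]
    ext
    · simp [mul_assoc]
    · push_cast
      simp [add_assoc]

open scoped Classical in
theorem inversionSign_wordProd (ω : List B) (t : W) :
    cs.inversionSign (cs.wordProd ω) t = ((cs.rightInvSeq ω).count t : ZMod 2) := by
  simp [inversionSign, signRep_wordProd_apply]

theorem inversionSign_mul (a b t : W) :
    cs.inversionSign (a * b) t = cs.inversionSign b t + cs.inversionSign a (b * t * b⁻¹) := by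
  obtain ⟨α, rfl⟩ := cs.wordProd_surjective a
  obtain ⟨γ, rfl⟩ := cs.wordProd_surjective b
  rw [inversionSign, map_mul]
  change (cs.signRep _ (cs.signRep _ (t, 0))).2 = _
  rw [signRep_wordProd_apply, signRep_wordProd_apply, inversionSign_wordProd,
    inversionSign_wordProd]
  simp

/-- For `t = w s w⁻¹`, the cocycle rule makes the contributions of `w` and `w⁻¹` cancel, as they do
in `w w⁻¹ = 1`; only the sign of `s` at `s` is left. -/
theorem inversionSign_self {t : W} (ht : cs.IsReflection t) : cs.inversionSign t t = 1 := by
  obtain ⟨w, i, rfl⟩ := ht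
  have h1 : cs.inversionSign (1 : W) (w * cs.simple i * w⁻¹) = 0 := by
    simpa using cs.inversionSign_wordProd [] (w * cs.simple i * w⁻¹)
  have h2 : cs.inversionSign (cs.simple i) (cs.simple i) = 1 := by
    simpa using cs.inversionSign_wordProd [i] (cs.simple i)
  rw [← mul_inv_cancel w, inversionSign_mul] at h1
  rw [inversionSign_mul, inversionSign_mul]
  simp only [mul_assoc, one_mul, inv_inv, inv_mul_cancel, mul_one, inv_mul_cancel_left, inv_simple,
    simple_mul_simple_self, h2] at h1 ⊢
  linear_combination h1

theorem mem_rightInvSeq_of_inversionSign_ne_zero {ω : List B} {t : W}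
    (h : cs.inversionSign (cs.wordProd ω) t ≠ 0) : t ∈ cs.rightInvSeq ω := by
  classical
  rw [inversionSign_wordProd] at h
  by_contra ht
  exact h (by simp [List.count_eq_zero_of_not_mem ht])

/-- Otherwise `w * t` has sign 1 at `t`, so `t` occurs in the inversion sequence of a reduced word
of `w * t` and shortens it, against `ℓ(wt) < ℓ(w)`. -/
theorem IsRightInversion.inversionSign_ne_zero {w t : W} (h : cs.IsRightInversion w t) :
    cs.inversionSign w t ≠ 0 := by
  intro h0
  have h1 : cs.inversionSign (w * t) t = 1 := by
    rw [inversionSign_mul, cs.inversionSign_self h.1]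
    simp [h0]
  obtain ⟨ω, hω, e⟩ := cs.exists_isReduced (w * t)
  have h2 : t ∈ cs.rightInvSeq ω :=
    cs.mem_rightInvSeq_of_inversionSign_ne_zero (by rw [← e, h1]; exact one_ne_zero)
  have h3 := (cs.isRightInversion_of_mem_rightInvSeq hω h2).2
  rw [← e, mul_assoc, h.1.mul_self, mul_one] at h3
  exact absurd h.2 (by omega)

/-- The strong exchange property. -/
theorem IsRightInversion.exists_eraseIdx {ω : List B} {t : W}
    (h : cs.IsRightInversion (cs.wordProd ω) t) :
    ∃ k < ω.length, cs.wordProd ω * t = cs.wordProd (ω.eraseIdx k) := by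
  have ht := cs.mem_rightInvSeq_of_inversionSign_ne_zero (h.inversionSign_ne_zero cs)
  obtain ⟨k, hk, rfl⟩ := List.getElem_of_mem ht
  refine ⟨k, by simpa using hk, ?_⟩
  rw [← wordProd_mul_getD_rightInvSeq, List.getD_eq_getElem _ _ hk]

theorem IsRightDescent.exists_eraseIdx {ω : List B} {i : B}
    (h : cs.IsRightDescent (cs.wordProd ω) i) :
    ∃ k < ω.length, cs.wordProd ω * cs.simple i = cs.wordProd (ω.eraseIdx k) :=
  ((cs.isRightInversion_simple_iff_isRightDescent _ i).2 h).exists_eraseIdx cs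

theorem IsLeftDescent.exists_eraseIdx {ω : List B} {i : B}
    (h : cs.IsLeftDescent (cs.wordProd ω) i) :
    ∃ k < ω.length, cs.simple i * cs.wordProd ω = cs.wordProd (ω.eraseIdx k) := by
  have ht : cs.IsRightInversion (cs.wordProd ω)
      ((cs.wordProd ω)⁻¹ * cs.simple i * cs.wordProd ω) := by
    refine ⟨⟨(cs.wordProd ω)⁻¹, i, by simp⟩, ?_⟩
    simpa [← mul_assoc, IsLeftDescent] using h
  simpa [← mul_assoc] using ht.exists_eraseIdx cs

/-- A reflection that occurs exactly once has sign 1, hence occurs in the sequence of any word with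
the same product; a reduced one is therefore at least as long. -/
theorem isReduced_of_nodup_rightInvSeq {ω : List B} (h : (cs.rightInvSeq ω).Nodup) :
    cs.IsReduced ω := by
  classical
  obtain ⟨ω', hω', e⟩ := cs.exists_isReduced (cs.wordProd ω)
  have hsub : cs.rightInvSeq ω ⊆ cs.rightInvSeq ω' := by
    intro t ht
    refine cs.mem_rightInvSeq_of_inversionSign_ne_zero ?_
    rw [← e, inversionSign_wordProd, List.count_eq_one_of_mem h ht]
    simp
  have h1 := (h.subperm hsub).length_le
  rw [length_rightInvSeq, length_rightInvSeq] at h1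
  have h2 := cs.length_wordProd_le ω
  have h3 := hω'.eq
  rw [← e] at h3
  unfold IsReduced
  omega

/-- Every word contains a reduced subword with the same product. -/
theorem exists_isReduced_sublist (ω : List B) :
    ∃ ω', List.Sublist ω' ω ∧ cs.IsReduced ω' ∧ cs.wordProd ω' = cs.wordProd ω := by
  induction ω with
  | nil => exact ⟨[], List.Sublist.refl _, by simp [IsReduced], rfl⟩
  | cons i ω ih =>
    obtain ⟨ω', hs, hr, e⟩ := ih
    by_cases hd : cs.IsLeftDescent (cs.wordProd ω') i
    · obtain ⟨k, hk, hk'⟩ := hd.exists_eraseIdx cs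
      refine ⟨ω'.eraseIdx k, ((List.eraseIdx_sublist _ _).trans hs).cons i, ?_, ?_⟩
      · unfold IsReduced
        rw [← hk', List.length_eraseIdx_of_lt hk]
        have := cs.isLeftDescent_iff.1 hd
        rw [hr.eq] at this
        omega
      · rw [← hk', wordProd_cons, e]
    · refine ⟨i :: ω', hs.cons_cons i, ?_, by rw [wordProd_cons, wordProd_cons, e]⟩
      unfold IsReduced
      rw [wordProd_cons, cs.not_isLeftDescent_iff.1 hd, hr.eq, List.length_cons]

/-! ### Dihedral parabolic subgroups -/

theorem IsReduced.of_append_left {ω ω' : List B} (h : cs.IsReduced (ω ++ ω')) :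
    cs.IsReduced ω := by
  simpa using h.take ω.length

theorem IsReduced.of_append_right {ω ω' : List B} (h : cs.IsReduced (ω ++ ω')) :
    cs.IsReduced ω' := by
  simpa using h.drop ω.length

/-- Every element is the product of an element which is minimal in its coset and of a reduced word
in the letters of `J`. -/
theorem exists_minimal_coset_representative (J : Set B) (v : W) :
    ∃ (y : W) (ω : List B), (∀ k ∈ ω, k ∈ J) ∧ cs.IsReduced ω ∧ v = y * cs.wordProd ω ∧
      ∀ ω' : List B, (∀ k ∈ ω', k ∈ J) → cs.IsReduced ω' →
        cs.length (y * cs.wordProd ω') = cs.length y + ω'.length := by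
  classical
  have hne : ∃ n, ∃ ω : List B, (∀ k ∈ ω, k ∈ J) ∧ cs.length (v * cs.wordProd ω) = n :=
    ⟨_, [], by simp, rfl⟩
  obtain ⟨α, hα, hαn⟩ := Nat.find_spec hne
  have hmin : ∀ ω : List B, (∀ k ∈ ω, k ∈ J) →
      cs.length (v * cs.wordProd α) ≤ cs.length (v * cs.wordProd α * cs.wordProd ω) := by
    intro ω hω
    rw [hαn, mul_assoc, ← wordProd_append]
    exact Nat.find_min' hne ⟨α ++ ω, by simpa [or_imp, forall_and] using ⟨hα, hω⟩, rfl⟩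
  obtain ⟨ω, hs, hr, e⟩ := cs.exists_isReduced_sublist α.reverse
  refine ⟨v * cs.wordProd α, ω, fun k hk => hα k (by simpa using hs.subset hk), hr, ?_, ?_⟩
  · rw [e]; simp
  set y := v * cs.wordProd α
  intro ω'
  induction ω' using List.reverseRecOn with
  | nil => simp
  | append_singleton ω k ih =>
    intro hJ hred
    have hωJ : ∀ k ∈ ω, k ∈ J := fun l hl => hJ l (by simp [hl])
    have hkJ : k ∈ J := hJ k (by simp)
    have ih' := ih hωJ (hred.of_append_left cs)
    by_cases hd : cs.IsRightDescent (y * cs.wordProd ω) k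
    · exfalso
      obtain ⟨ζ, hζ, hy⟩ := cs.exists_isReduced y
      rw [hy, ← wordProd_append] at hd
      obtain ⟨l, hl, he⟩ := hd.exists_eraseIdx cs
      -- Deleting a letter of `ζ` would give an element of the coset shorter than `y`; deleting one
      -- of `ω` would contradict that `ω ++ [k]` is reduced.
      rcases lt_or_ge l ζ.length with h | h
      · rw [List.eraseIdx_append_of_lt_length h, wordProd_append, wordProd_append] at he
        have h1 := hmin (ω ++ [k] ++ ω.reverse) (by
          simp only [List.mem_append, List.mem_reverse, List.mem_singleton]
          rintro x ((hx | rfl) | hx)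
          exacts [hωJ x hx, hkJ, hωJ x hx])
        have h2 : y * cs.wordProd (ω ++ [k] ++ ω.reverse) = cs.wordProd (ζ.eraseIdx l) := by
          rw [wordProd_append, wordProd_append, wordProd_reverse, wordProd_singleton, hy,
            ← mul_assoc, ← mul_assoc, he, mul_inv_cancel_right]
        rw [h2] at h1
        have h3 := cs.length_wordProd_le (ζ.eraseIdx l)
        rw [List.length_eraseIdx_of_lt h] at h3
        have h4 := hζ.eq
        rw [← hy] at h4
        omega
      · rw [List.eraseIdx_append_of_length_le h, wordProd_append, wordProd_append, mul_assoc,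
          mul_left_cancel_iff] at he
        have h3 := cs.length_wordProd_le (ω.eraseIdx (l - ζ.length))
        have h4 := hred.eq
        rw [wordProd_append, wordProd_singleton, he, List.length_append] at h4
        have h5 := List.length_eraseIdx_le ω (l - ζ.length)
        simp only [List.length_singleton] at h4
        omega
    · rw [wordProd_append, wordProd_singleton, ← mul_assoc, cs.not_isRightDescent_iff.1 hd, ih',
        List.length_append, List.length_singleton, add_assoc]

theorem rightInvSeq_alternatingWord (i j : B) (n : ℕ) :
    cs.rightInvSeq (alternatingWord i j n) =
      ((List.range n).map fun q =>
        cs.simple j * (cs.simple i * cs.simple j) ^ q).reverse := by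
  induction n generalizing i j with
  | zero => simp [alternatingWord]
  | succ n ih =>
    rw [alternatingWord_succ, rightInvSeq_concat, ih, List.range_succ_eq_map]
    simp only [List.map_reverse, List.map_map, List.map_cons, List.reverse_cons, pow_zero, mul_one,
      List.concat_eq_append]
    congr 2
    refine List.map_congr_left fun q _ => ?_
    simp only [Function.comp, MulAut.conj_apply, inv_simple]
    have h := (SemiconjBy.pow_right (a := cs.simple j) (x := cs.simple i * cs.simple j)
      (y := cs.simple j * cs.simple i) (by simp [SemiconjBy, mul_assoc]) q).eq
    rw [pow_succ', ← mul_assoc, mul_assoc _ _ (cs.simple j)]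
    rw [mul_assoc (cs.simple i), ← h]
    simp [mul_assoc]

theorem orderOf_simple_mul_simple_comm (i j : B) :
    orderOf (cs.simple j * cs.simple i) = orderOf (cs.simple i * cs.simple j) := by
  rw [← orderOf_inv (cs.simple i * cs.simple j)]
  simp

theorem isReduced_alternatingWord {i j : B} {n : ℕ}
    (h : n ≤ orderOf (cs.simple i * cs.simple j)) : cs.IsReduced (alternatingWord i j n) := by
  apply cs.isReduced_of_nodup_rightInvSeq
  rw [rightInvSeq_alternatingWord, List.nodup_reverse]
  refine List.Nodup.map_on ?_ List.nodup_range
  intro x hx y hy e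
  rw [List.mem_range] at hx hy
  exact pow_injOn_Iio_orderOf (Set.mem_Iio.2 (hx.trans_le h)) (Set.mem_Iio.2 (hy.trans_le h))
    (mul_left_cancel e)

/-- The exponents 0 and `m` give the same entry of the inversion sequence, which has no repetition
when the word is reduced. Finiteness ensures `m > 0`. -/
theorem le_orderOf_of_isReduced_alternatingWord [Finite W] {i j : B} {n : ℕ}
    (h : cs.IsReduced (alternatingWord i j n)) : n ≤ orderOf (cs.simple i * cs.simple j) := by
  by_contra! hn
  have h1 := h.nodup_rightInvSeq
  rw [rightInvSeq_alternatingWord, List.nodup_reverse] at h1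
  have h2 := List.inj_on_of_nodup_map h1
    (List.mem_range.2 ((orderOf_pos (cs.simple i * cs.simple j)).trans hn)) (List.mem_range.2 hn)
    (by rw [pow_orderOf_eq_one, pow_zero])
  exact (orderOf_pos (cs.simple i * cs.simple j)).ne h2

/-- A reduced word in two letters is alternating. -/
theorem IsReduced.eq_alternatingWord {i j : B} {ω : List B} (h : cs.IsReduced ω)
    (hω : ∀ k ∈ ω, k ∈ ({i, j} : Set B)) :
    ω = alternatingWord i j ω.length ∨ ω = alternatingWord j i ω.length := by
  induction ω using List.reverseRecOn with
  | nil => simp [alternatingWord]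
  | append_singleton ω k ih =>
    have key : ∀ a b : B, k ∈ ({a, b} : Set B) → ω = alternatingWord a b ω.length →
        ω ++ [k] = alternatingWord a b (ω.length + 1) ∨
          ω ++ [k] = alternatingWord b a (ω.length + 1) := by
      intro a b hk e
      rcases hk with rfl | rfl
      · right
        rw [alternatingWord_succ, ← e, List.concat_eq_append]
      · rcases hn : ω.length with _ | n
        · left
          rw [List.length_eq_zero_iff.1 hn]
          rfl
        · exfalso
          rw [hn, alternatingWord_succ, List.concat_eq_append] at e
          rw [e, List.append_assoc] at h
          have h1 := (h.of_append_right cs).eq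
          simp [wordProd] at h1
    have hk := hω k (by simp)
    rw [List.length_append, List.length_singleton]
    rcases ih (h.of_append_left cs) (fun l hl => hω l (by simp [hl])) with e | e
    · exact key i j hk e
    · exact (key j i (by rwa [Set.pair_comm]) e).symm

/-- The longest element of the parabolic subgroup generated by `s_i` and `s_j`. -/
noncomputable def dihedralLongest (i j : B) : W := cs.wordProd (cs.braidSide i j)

theorem dihedralLongest_comm (i j : B) : cs.dihedralLongest j i = cs.dihedralLongest i j := by
  rw [dihedralLongest, dihedralLongest, braidSide, braidSide, orderOf_simple_mul_simple_comm,
    prod_alternatingWord_eq_mul_pow, prod_alternatingWord_eq_mul_pow]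
  have hx : cs.simple j * cs.simple i = (cs.simple i * cs.simple j)⁻¹ := by simp
  have hm := pow_orderOf_eq_one (cs.simple i * cs.simple j)
  rw [hx]
  set x := cs.simple i * cs.simple j with hxx
  set m := orderOf x
  rcases Nat.even_or_odd' m with ⟨k, hk | hk⟩
  · rw [hk, if_pos (by simp), if_pos (by simp), Nat.mul_div_cancel_left k two_pos, one_mul,
      one_mul, inv_pow, inv_eq_iff_mul_eq_one, ← pow_add, ← two_mul, ← hk, hm]
  · rw [hk, if_neg (by simp), if_neg (by simp), show (2 * k + 1) / 2 = k by omega, inv_pow,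
      mul_inv_eq_iff_eq_mul, ← inv_simple, inv_eq_iff_mul_eq_one, ← mul_assoc, ← mul_assoc,
      ← hxx, ← pow_succ', ← pow_add, show k + 1 + k = m by omega, hm]

theorem isReduced_braidSide (i j : B) : cs.IsReduced (cs.braidSide i j) :=
  cs.isReduced_alternatingWord le_rfl

theorem mem_alternatingWord {i j k : B} {n : ℕ} (h : k ∈ alternatingWord i j n) :
    k ∈ ({i, j} : Set B) := by
  induction n generalizing i j with
  | zero => simp [alternatingWord] at h
  | succ n ih =>
    rw [alternatingWord_succ, List.concat_eq_append, List.mem_append, List.mem_singleton] at h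
    rcases h with h | rfl
    · rw [Set.pair_comm]; exact ih h
    · simp

theorem dihedralLongest_inv (i j : B) :
    (cs.dihedralLongest i j)⁻¹ = cs.dihedralLongest i j := by
  have hr : cs.IsReduced (cs.braidSide i j).reverse := (cs.isReduced_braidSide i j).reverse
  rw [dihedralLongest, ← wordProd_reverse]
  rcases hr.eq_alternatingWord cs (i := i) (j := j) (fun k hk => mem_alternatingWord
    (List.mem_reverse.1 hk)) with e | e
  · rw [e, List.length_reverse, braidSide, length_alternatingWord]
  · rw [e, List.length_reverse, braidSide, length_alternatingWord]
    have := cs.dihedralLongest_comm i j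
    rwa [dihedralLongest, dihedralLongest, braidSide, orderOf_simple_mul_simple_comm] at this

theorem braidSide_eq_concat [Finite W] (i j : B) : cs.braidSide i j =
    alternatingWord j i (orderOf (cs.simple i * cs.simple j) - 1) ++ [j] := by
  rw [braidSide, ← List.concat_eq_append, ← alternatingWord_succ,
    Nat.sub_add_cancel (orderOf_pos _)]

theorem isRightDescent_dihedralLongest [Finite W] (i j : B) :
    cs.IsRightDescent (cs.dihedralLongest i j) j := by
  have h1 := cs.isReduced_braidSide i j
  unfold IsRightDescent dihedralLongest
  rw [h1.eq, braidSide_eq_concat, wordProd_append, wordProd_singleton,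
    simple_mul_simple_cancel_right, List.length_append, List.length_singleton]
  exact Nat.lt_succ_of_le (cs.length_wordProd_le _)

/-- If neither `s_i` nor `s_j` is a right descent of `x`, then the length is additive on the product
of `x` with the longest element of the dihedral group. -/
theorem length_mul_dihedralLongest_of_not_isRightDescent {x : W} {i j : B}
    (hi : ¬ cs.IsRightDescent x i) (hj : ¬ cs.IsRightDescent x j) :
    cs.length (x * cs.dihedralLongest i j) = cs.length x + cs.length (cs.dihedralLongest i j) := by
  obtain ⟨y, ω, hω, hr, rfl, h⟩ := cs.exists_minimal_coset_representative {i, j} x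
  rcases List.eq_nil_or_concat' ω with rfl | ⟨ω', k, rfl⟩
  · rw [dihedralLongest, (cs.isReduced_braidSide i j).eq, wordProd_nil, mul_one]
    exact h _ (fun k hk => mem_alternatingWord hk) (cs.isReduced_braidSide i j)
  · exfalso
    have hd : cs.IsRightDescent (y * cs.wordProd (ω' ++ [k])) k := by
      unfold IsRightDescent
      rw [h _ hω hr, wordProd_append, wordProd_singleton, mul_assoc, simple_mul_simple_cancel_right,
        h _ (fun l hl => hω l (by simp [hl])) (hr.of_append_left cs)]
      simp
    rcases hω k (by simp) with rfl | hk
    · exact hi hd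
    · rw [Set.mem_singleton_iff] at hk
      exact hj (hk ▸ hd)

/-- If `s_i` and `s_j` are right descents of `v`, then the longest element of the dihedral group is
a suffix of `v`. -/
theorem exists_eq_mul_dihedralLongest [Finite W] {v : W} {i j : B}
    (hi : cs.IsRightDescent v i) (hj : cs.IsRightDescent v j) :
    ∃ y, v = y * cs.dihedralLongest i j ∧
      cs.length v = cs.length y + cs.length (cs.dihedralLongest i j) := by
  obtain ⟨y, ω, hω, hr, rfl, h⟩ := cs.exists_minimal_coset_representative {i, j} v
  have key : ∀ a b : B, ({a, b} : Set B) = {i, j} → ω = alternatingWord a b ω.length →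
      cs.IsRightDescent (y * cs.wordProd ω) a →
      cs.wordProd ω = cs.dihedralLongest a b := by
    intro a b hab e ha
    have h1 : ω.length ≤ orderOf (cs.simple a * cs.simple b) :=
      cs.le_orderOf_of_isReduced_alternatingWord (e ▸ hr)
    rcases h1.eq_or_lt with h2 | h2
    · rw [dihedralLongest, braidSide, ← h2, ← e]
    -- An alternating word with fewer than `m` letters, ending in `b`, stays reduced when `a` is
    -- appended, so `a` would not be a descent.
    · exfalso
      have h3 : ω ++ [a] = alternatingWord b a (ω.length + 1) := by
        rw [alternatingWord_succ, ← e, List.concat_eq_append]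
      have h4 := h (ω ++ [a]) (by
        rw [h3, ← hab, Set.pair_comm]
        exact fun k hk => mem_alternatingWord hk) (by
        rw [h3]
        exact cs.isReduced_alternatingWord (by rwa [orderOf_simple_mul_simple_comm]))
      have h5 := h ω hω hr
      unfold IsRightDescent at ha
      rw [wordProd_append, wordProd_singleton, ← mul_assoc, List.length_append] at h4
      omega
  have hw : cs.wordProd ω = cs.dihedralLongest i j := by
    rcases hr.eq_alternatingWord cs hω with e | e
    · exact key i j rfl e hi
    · rw [← dihedralLongest_comm]
      exact key j i (Set.pair_comm _ _) e hj
  exact ⟨y, by rw [hw], by rw [h ω hω hr, ← hr.eq, hw]⟩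

/-! ### Positive lifts in the braid monoid -/

/-- The element of the braid monoid that is represented by a word. -/
def braidMk (ω : List B) : cs.BraidMonoid := PresentedMonoid.mk cs.BraidRel (FreeMonoid.ofList ω)

@[simp]
theorem braidMk_nil : cs.braidMk [] = 1 := rfl

theorem braidMk_append (ω ω' : List B) :
    cs.braidMk (ω ++ ω') = cs.braidMk ω * cs.braidMk ω' := rfl

theorem exists_braidMk_eq (a : cs.BraidMonoid) : ∃ ω, cs.braidMk ω = a := by
  obtain ⟨w, rfl⟩ := PresentedMonoid.surjective_mk a
  exact ⟨w.toList, rfl⟩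

theorem braidMk_braidSide (i j : B) :
    cs.braidMk (cs.braidSide i j) = cs.braidMk (cs.braidSide j i) :=
  PresentedMonoid.mk_eq_mk_of_rel (BraidRel.braid i j)

theorem IsReduced.of_length_mul {ω ω' : List B} (h : cs.IsReduced ω) (h' : cs.IsReduced ω')
    (hl : cs.length (cs.wordProd ω * cs.wordProd ω') =
      cs.length (cs.wordProd ω) + cs.length (cs.wordProd ω')) : cs.IsReduced (ω ++ ω') := by
  unfold IsReduced
  rw [wordProd_append, hl, h.eq, h'.eq, List.length_append]

/-- Matsumoto's theorem: two reduced words with the same product represent the same element of the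
braid monoid. -/
theorem IsReduced.braidMk_eq [Finite W] {ω ω' : List B} (h : cs.IsReduced ω)
    (h' : cs.IsReduced ω') (e : cs.wordProd ω = cs.wordProd ω') :
    cs.braidMk ω = cs.braidMk ω' := by
  induction hn : ω.length generalizing ω ω' with
  | zero =>
    have h1 := h'.eq
    rw [← e, h.eq, hn] at h1
    rw [List.length_eq_zero_iff.1 hn, List.length_eq_zero_iff.1 h1.symm]
  | succ n ih =>
    have hn' : ω'.length = n + 1 := by rw [← h'.eq, ← e, h.eq, hn]
    rcases List.eq_nil_or_concat' ω with rfl | ⟨α, i, rfl⟩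
    · simp at hn
    rcases List.eq_nil_or_concat' ω' with rfl | ⟨α', j, rfl⟩
    · simp at hn'
    have hd : ∀ (γ : List B) (k : B), cs.IsReduced (γ ++ [k]) →
        cs.IsRightDescent (cs.wordProd (γ ++ [k])) k := by
      intro γ k hγ
      unfold IsRightDescent
      rw [hγ.eq, wordProd_append, wordProd_singleton, simple_mul_simple_cancel_right,
        (hγ.of_append_left cs).eq]
      simp
    have hdi := hd _ _ h
    have hdj := hd _ _ h'
    rw [← e] at hdj
    obtain ⟨y, hy, hly⟩ := cs.exists_eq_mul_dihedralLongest hdi hdj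
    obtain ⟨ζ, hζ, rfl⟩ := cs.exists_isReduced y
    -- Both words are compared with `ζ` followed by a side of the braid relation. The side is chosen
    -- to end in the same letter, so induction applies once that letter is removed.
    have key : ∀ (γ : List B) (a b : B), cs.IsReduced (γ ++ [b]) → (γ ++ [b]).length = n + 1 →
        cs.wordProd (γ ++ [b]) = cs.wordProd (α ++ [i]) →
        cs.dihedralLongest a b = cs.dihedralLongest i j →
        cs.braidMk (γ ++ [b]) = cs.braidMk (ζ ++ cs.braidSide a b) := by
      intro γ a b hγ hl hp hab
      have hr : cs.IsReduced (ζ ++ cs.braidSide a b) := by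
        refine hζ.of_length_mul cs (cs.isReduced_braidSide a b) ?_
        change cs.length (_ * cs.dihedralLongest a b) = _ + cs.length (cs.dihedralLongest a b)
        rw [hab, ← hy, hly]
      have hp' : cs.wordProd (ζ ++ cs.braidSide a b) = cs.wordProd (γ ++ [b]) := by
        rw [hp, hy, ← hab, wordProd_append, dihedralLongest]
      rw [braidSide_eq_concat, ← List.append_assoc] at hr hp' ⊢
      rw [braidMk_append, braidMk_append _ (_ ++ _)]
      congr 1
      refine ih (hγ.of_append_left cs) (hr.of_append_left cs) ?_ (by simpa using hl)
      rw [wordProd_append, wordProd_append _ γ] at hp'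
      exact (mul_right_cancel hp').symm
    rw [key α j i h hn rfl (cs.dihedralLongest_comm i j), key α' i j h' hn' e.symm rfl,
      braidMk_append, braidMk_append, braidMk_braidSide]

/-- The positive lift of an element of `W` to the braid monoid. -/
noncomputable def posLift (w : W) : cs.BraidMonoid := cs.braidMk (cs.exists_isReduced w).choose

/-- The length is additive on the product of `x` and `y`. -/
def LengthAdd (x y : W) : Prop := cs.length (x * y) = cs.length x + cs.length y

theorem lengthAdd_one_left (w : W) : cs.LengthAdd 1 w := by simp [LengthAdd]

theorem lengthAdd_one_right (w : W) : cs.LengthAdd w 1 := by simp [LengthAdd]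

variable {cs}

theorem LengthAdd.of_mul_left {x y z : W} (h : cs.LengthAdd x y) (h' : cs.LengthAdd (x * y) z) :
    cs.LengthAdd y z ∧ cs.LengthAdd x (y * z) := by
  unfold LengthAdd at *
  have h1 := cs.length_mul_le y z
  have h2 := cs.length_mul_le x (y * z)
  rw [mul_assoc] at h'
  omega

theorem LengthAdd.of_mul_right {x y z : W} (h : cs.LengthAdd y z)
    (h' : cs.LengthAdd x (y * z)) : cs.LengthAdd x y ∧ cs.LengthAdd (x * y) z := by
  unfold LengthAdd at *
  have h1 := cs.length_mul_le x y
  have h2 := cs.length_mul_le (x * y) z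
  rw [mul_assoc] at h2 ⊢
  omega

variable (cs)

theorem IsReduced.posLift_wordProd [Finite W] {ω : List B} (h : cs.IsReduced ω) :
    cs.posLift (cs.wordProd ω) = cs.braidMk ω :=
  (cs.exists_isReduced _).choose_spec.1.braidMk_eq cs h
    (cs.exists_isReduced _).choose_spec.2.symm

theorem posLift_mul [Finite W] {x y : W} (h : cs.LengthAdd x y) :
    cs.posLift (x * y) = cs.posLift x * cs.posLift y := by
  obtain ⟨ω, hω, rfl⟩ := cs.exists_isReduced x
  obtain ⟨ω', hω', rfl⟩ := cs.exists_isReduced y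
  rw [hω.posLift_wordProd, hω'.posLift_wordProd, ← braidMk_append, ← wordProd_append]
  exact (hω.of_length_mul cs hω' h).posLift_wordProd cs

@[simp]
theorem posLift_one [Finite W] : cs.posLift 1 = 1 :=
  IsReduced.posLift_wordProd cs (ω := []) (by simp [IsReduced])

theorem posLift_simple [Finite W] (i : B) : cs.posLift (cs.simple i) = cs.braidMk [i] := by
  rw [← IsReduced.posLift_wordProd cs (ω := [i]) (by simp [IsReduced]), wordProd_singleton]

/-! ### The prefix order on `W` -/

/-- `p` is a prefix of `v`: some reduced word of `p` extends to a reduced word of `v`. -/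
def IsPrefix (p v : W) : Prop := cs.LengthAdd p (p⁻¹ * v)

theorem isPrefix_refl (v : W) : cs.IsPrefix v v := by simp [IsPrefix, LengthAdd]

theorem one_isPrefix (v : W) : cs.IsPrefix 1 v := by simp [IsPrefix, LengthAdd]

variable {cs}

theorem LengthAdd.isPrefix {x y : W} (h : cs.LengthAdd x y) : cs.IsPrefix x (x * y) := by
  simpa [IsPrefix] using h

theorem IsPrefix.length_eq {p v : W} (h : cs.IsPrefix p v) :
    cs.length v = cs.length p + cs.length (p⁻¹ * v) := by
  simpa [IsPrefix, LengthAdd] using h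

theorem IsPrefix.trans {p q v : W} (h : cs.IsPrefix p q) (h' : cs.IsPrefix q v) :
    cs.IsPrefix p v ∧ cs.LengthAdd (p⁻¹ * q) (q⁻¹ * v) := by
  have h1 : cs.LengthAdd (p * (p⁻¹ * q)) (q⁻¹ * v) := by
    rw [mul_inv_cancel_left]
    exact h'
  obtain ⟨h2, h3⟩ := LengthAdd.of_mul_left h h1
  refine ⟨?_, h2⟩
  unfold IsPrefix
  convert h3 using 1
  group

theorem IsPrefix.antisymm {p q : W} (h : cs.IsPrefix p q) (h' : cs.IsPrefix q p) : p = q := by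
  have h1 := h.length_eq
  have h2 := h'.length_eq
  have h3 : cs.length (p⁻¹ * q) = 0 := by omega
  rw [length_eq_zero_iff, inv_mul_eq_one] at h3
  exact h3

theorem LengthAdd.mono_right {w p q : W} (h : cs.LengthAdd w q) (hp : cs.IsPrefix p q) :
    cs.LengthAdd w p :=
  (LengthAdd.of_mul_right hp (by simpa using h)).1

variable (cs)

theorem IsPrefix.exists_simple {p q : W} (h : cs.IsPrefix p q) (hne : p ≠ q) :
    ∃ i, ¬ cs.IsRightDescent p i ∧ cs.IsPrefix (p * cs.simple i) q := by
  have h0 : p⁻¹ * q ≠ 1 := by rwa [Ne, inv_mul_eq_one]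
  obtain ⟨i, hi⟩ := cs.exists_leftDescent_of_ne_one h0
  have h1 : cs.LengthAdd (cs.simple i) (cs.simple i * (p⁻¹ * q)) := by
    have := cs.isLeftDescent_iff.1 hi
    unfold LengthAdd
    rw [simple_mul_simple_cancel_left, length_simple]
    omega
  obtain ⟨h2, h3⟩ := LengthAdd.of_mul_right (x := p) h1
    (by rw [simple_mul_simple_cancel_left]; exact h)
  refine ⟨i, ?_, ?_⟩
  · rw [not_isRightDescent_iff, h2, length_simple]
  · unfold IsPrefix
    convert h3 using 1
    simp [mul_assoc]

theorem isLeftDescent_of_isPrefix_mul_simple {p v : W} {i : B} (hi : ¬ cs.IsRightDescent p i)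
    (h : cs.IsPrefix (p * cs.simple i) v) : cs.IsLeftDescent (p⁻¹ * v) i := by
  rw [not_isRightDescent_iff] at hi
  have h1 := h.length_eq
  have h2 := cs.length_mul_le p (p⁻¹ * v)
  rw [mul_inv_cancel_left] at h2
  simp only [mul_inv_rev, inv_simple, mul_assoc] at h1
  unfold IsLeftDescent
  omega

theorem isPrefix_mul_dihedralLongest [Finite W] {p v : W} {i j : B}
    (hi : ¬ cs.IsRightDescent p i) (hj : ¬ cs.IsRightDescent p j)
    (hi' : cs.IsPrefix (p * cs.simple i) v) (hj' : cs.IsPrefix (p * cs.simple j) v) :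
    cs.IsPrefix (p * cs.dihedralLongest i j) v := by
  have h1 := cs.isLeftDescent_of_isPrefix_mul_simple hi hi'
  have h2 := cs.isLeftDescent_of_isPrefix_mul_simple hj hj'
  rw [← isRightDescent_inv_iff] at h1 h2
  obtain ⟨y, hy, hl⟩ := cs.exists_eq_mul_dihedralLongest h1 h2
  have h3 : p⁻¹ * v = cs.dihedralLongest i j * y⁻¹ := by
    rw [← inv_inj, hy, mul_inv_rev, inv_inv, dihedralLongest_inv]
  have hp : cs.IsPrefix p v :=
    (IsPrefix.trans (LengthAdd.isPrefix (by
      rw [LengthAdd, length_simple, cs.not_isRightDescent_iff.1 hi])) hi').1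
  have h4 : cs.LengthAdd (cs.dihedralLongest i j) y⁻¹ := by
    rw [LengthAdd, ← h3, ← length_inv, hl, length_inv, add_comm]
  have h5 := (LengthAdd.of_mul_right (x := p) h4 (by rw [← h3]; exact hp)).2
  unfold IsPrefix
  convert h5 using 1
  rw [mul_inv_rev, mul_assoc, h3, inv_mul_cancel_left]

theorem isPrefix_mul_dihedralLongest_self [Finite W] {p : W} {i j : B}
    (hi : ¬ cs.IsRightDescent p i) (hj : ¬ cs.IsRightDescent p j) :
    cs.IsPrefix (p * cs.simple i) (p * cs.dihedralLongest i j) := by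
  have h1 := cs.isRightDescent_dihedralLongest j i
  rw [dihedralLongest_comm, ← isLeftDescent_inv_iff, dihedralLongest_inv, isLeftDescent_iff] at h1
  have h2 := cs.length_mul_dihedralLongest_of_not_isRightDescent hi hj
  have h3 := cs.not_isRightDescent_iff.1 hi
  rw [IsPrefix, LengthAdd, mul_inv_cancel_left, h2, h3]
  simp only [mul_inv_rev, inv_simple, mul_assoc, inv_mul_cancel_left]
  omega

/-- Among the prefixes `p` of `v` such that the length is additive on the product of `w` and `p`,
there is a greatest one. -/
theorem exists_greatest_prefix [Finite W] (w v : W) :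
    ∃ p, cs.IsPrefix p v ∧ cs.LengthAdd w p ∧
      ∀ q, cs.IsPrefix q v → cs.LengthAdd w q → cs.IsPrefix q p := by
  -- Only prefixes above a fixed `p` are compared, so that induction can climb from `p` to `p *
  -- s_i`.
  suffices H : ∀ n p, cs.length v - cs.length p = n → cs.IsPrefix p v → cs.LengthAdd w p →
      ∃ m, cs.IsPrefix p m ∧ cs.IsPrefix m v ∧ cs.LengthAdd w m ∧
        ∀ q, cs.IsPrefix q v → cs.LengthAdd w q → cs.IsPrefix p q → cs.IsPrefix q m by
    obtain ⟨m, -, h2, h3, h4⟩ := H _ 1 rfl (cs.one_isPrefix v) (cs.lengthAdd_one_right w)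
    exact ⟨m, h2, h3, fun q hq hq' => h4 q hq hq' (cs.one_isPrefix q)⟩
  intro n
  induction n using Nat.strong_induction_on with
  | _ n ih =>
    rintro p rfl hp hwp
    have up : ∀ r, cs.length p < cs.length r → cs.IsPrefix r v → cs.LengthAdd w r →
        ∃ m, cs.IsPrefix r m ∧ cs.IsPrefix m v ∧ cs.LengthAdd w m ∧
        ∀ q, cs.IsPrefix q v → cs.LengthAdd w q → cs.IsPrefix r q → cs.IsPrefix q m := by
      intro r hr hrv hwr
      have := hrv.length_eq
      exact ih _ (by omega) r rfl hrv hwr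
    by_cases hex : ∃ i, ¬ cs.IsRightDescent p i ∧ cs.IsPrefix (p * cs.simple i) v ∧
        cs.LengthAdd w (p * cs.simple i)
    · obtain ⟨i, hi, hiv, hwi⟩ := hex
      have hli := cs.not_isRightDescent_iff.1 hi
      have hpi : cs.IsPrefix p (p * cs.simple i) :=
        LengthAdd.isPrefix (by rw [LengthAdd, length_simple, hli])
      obtain ⟨m, hm1, hm2, hm3, hm4⟩ := up _ (by omega) hiv hwi
      refine ⟨m, (hpi.trans hm1).1, hm2, hm3, fun q hq hwq hpq => ?_⟩
      by_cases hne : p = q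
      · exact hne ▸ (hpi.trans hm1).1
      obtain ⟨j, hj, hjq⟩ := hpq.exists_simple cs hne
      have hlj := cs.not_isRightDescent_iff.1 hj
      have hjv := (hjq.trans hq).1
      have hwj := hwq.mono_right hjq
      obtain ⟨m', hm1', hm2', hm3', hm4'⟩ := up _ (by omega) hjv hwj
      -- Diamond argument: with `m''` the greatest element above the join `p * dihedralLongest i j`,
      -- one gets `q ≤ m' ≤ m'' ≤ m`.
      refine ((hm4' q hq hwq hjq).trans ?_).1
      have hδv := cs.isPrefix_mul_dihedralLongest hi hj hiv hjv
      have hδi := cs.isPrefix_mul_dihedralLongest_self hi hj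
      have hδj := cs.isPrefix_mul_dihedralLongest_self hj hi
      rw [dihedralLongest_comm] at hδj
      have hdesc : ∀ k, ¬ cs.IsRightDescent p k → cs.LengthAdd w (p * cs.simple k) →
          ¬ cs.IsRightDescent (w * p) k := by
        intro k hk hwk
        have h1 := cs.not_isRightDescent_iff.1 hk
        rw [not_isRightDescent_iff, mul_assoc, hwk, h1, hwp, add_assoc]
      have hwδ : cs.LengthAdd w (p * cs.dihedralLongest i j) :=
        (LengthAdd.of_mul_left hwp (cs.length_mul_dihedralLongest_of_not_isRightDescent
          (hdesc i hi hwi) (hdesc j hj hwj))).2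
      obtain ⟨m'', hm1'', hm2'', hm3'', hm4''⟩ := up _ (by
        have := hδi.length_eq
        omega) hδv hwδ
      have h1 := hm4'' m' hm2' hm3' (hm4' _ hδv hwδ hδj)
      exact (h1.trans (hm4 m'' hm2'' hm3'' (hδi.trans hm1'').1)).1
    · refine ⟨p, cs.isPrefix_refl p, hp, hwp, fun q hq hwq hpq => ?_⟩
      by_cases hne : p = q
      · exact hne ▸ cs.isPrefix_refl p
      obtain ⟨j, hj, hjq⟩ := hpq.exists_simple cs hne
      exact absurd ⟨j, hj, (hjq.trans hq).1, hwq.mono_right hjq⟩ hex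

/-! ### The action of the braid monoid on sequences of elements of `W` -/

section Action

variable [Finite W]

/-- The greatest prefix `p` of `v` such that the length is additive on the product of `w`
and `p`. -/
noncomputable def greatestPrefix (w v : W) : W := (cs.exists_greatest_prefix w v).choose

theorem greatestPrefix_isPrefix (w v : W) : cs.IsPrefix (cs.greatestPrefix w v) v :=
  (cs.exists_greatest_prefix w v).choose_spec.1

theorem lengthAdd_greatestPrefix (w v : W) : cs.LengthAdd w (cs.greatestPrefix w v) :=
  (cs.exists_greatest_prefix w v).choose_spec.2.1

theorem IsPrefix.le_greatestPrefix {w v q : W} (h : cs.IsPrefix q v) (h' : cs.LengthAdd w q) :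
    cs.IsPrefix q (cs.greatestPrefix w v) :=
  (cs.exists_greatest_prefix w v).choose_spec.2.2 q h h'

theorem greatestPrefix_eq_of_lengthAdd {w v : W} (h : cs.LengthAdd w v) :
    cs.greatestPrefix w v = v :=
  (cs.greatestPrefix_isPrefix w v).antisymm ((cs.isPrefix_refl v).le_greatestPrefix cs h)

/-- Absorbing in two stages agrees with absorbing at once. Since `u` is itself admissible for `w`,
the greatest prefix of `u * q` begins with `u`, and what follows `u` is admissible for `w * u`. -/
theorem greatestPrefix_mul {w u : W} (h : cs.LengthAdd w u) (v : W) :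
    cs.greatestPrefix w (u * cs.greatestPrefix u v) = u * cs.greatestPrefix (w * u) v ∧
      cs.IsPrefix (cs.greatestPrefix (w * u) v) (cs.greatestPrefix u v) := by
  set q := cs.greatestPrefix u v with hq
  set p := cs.greatestPrefix (w * u) v with hp
  have hwup := cs.lengthAdd_greatestPrefix (w * u) v
  rw [← hp] at hwup
  obtain ⟨hup, hwup'⟩ := LengthAdd.of_mul_left h hwup
  have huq : cs.LengthAdd u q := cs.lengthAdd_greatestPrefix u v
  have hqv : cs.IsPrefix q v := cs.greatestPrefix_isPrefix u v
  have hpq : cs.IsPrefix p q := (cs.greatestPrefix_isPrefix (w * u) v).le_greatestPrefix cs hup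
  refine ⟨?_, hpq⟩
  set r := cs.greatestPrefix w (u * q) with hr
  have hrq : cs.IsPrefix r (u * q) := cs.greatestPrefix_isPrefix w (u * q)
  have hwr : cs.LengthAdd w r := cs.lengthAdd_greatestPrefix w (u * q)
  have hur : cs.IsPrefix u r := huq.isPrefix.le_greatestPrefix cs h
  have hupq : cs.IsPrefix (u * p) (u * q) := by
    have := (LengthAdd.of_mul_right (x := u) hpq (by rw [mul_inv_cancel_left]; exact huq)).2
    unfold IsPrefix
    convert this using 1
    group
  refine IsPrefix.antisymm ?_ (hupq.le_greatestPrefix cs hwup')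
  have h1 : cs.IsPrefix (u⁻¹ * r) q := by
    have h2 := (hur.trans hrq).2
    unfold IsPrefix
    convert h2 using 1
    group
  have h3 : cs.LengthAdd (w * u) (u⁻¹ * r) :=
    (LengthAdd.of_mul_right (x := w) hur (by rw [mul_inv_cancel_left]; exact hwr)).2
  have h4 : cs.IsPrefix (u⁻¹ * r) p := (h1.trans hqv).1.le_greatestPrefix cs h3
  have h5 := (LengthAdd.of_mul_right (x := u) h4 (by rw [mul_inv_cancel_left]; exact hup)).2
  unfold IsPrefix
  convert h5 using 1 <;> group

open scoped Classical in
/-- The action of `w` on sequences: it multiplies the first term by as much as possible of `w`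
without cancellation, moving the rest of the first term to the right. -/
noncomputable def seqSMul : W → List W → List W
  | w, [] => if w = 1 then [] else [w]
  | w, v :: L => (w * cs.greatestPrefix w v) :: seqSMul ((cs.greatestPrefix w v)⁻¹ * v) L

theorem seqSMul_one (L : List W) : cs.seqSMul 1 L = L := by
  induction L with
  | nil => simp [seqSMul]
  | cons v L ih =>
    rw [seqSMul, cs.greatestPrefix_eq_of_lengthAdd (cs.lengthAdd_one_left v), one_mul,
      inv_mul_cancel, ih]

/-- By `greatestPrefix_mul` the first terms agree. The remainders `p⁻¹q` and `q⁻¹v` multiply to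
`p⁻¹v` with additive lengths because `p ≤ q ≤ v`, so induction applies to the tail. -/
theorem seqSMul_mul {w u : W} (h : cs.LengthAdd w u) (L : List W) :
    cs.seqSMul w (cs.seqSMul u L) = cs.seqSMul (w * u) L := by
  induction L generalizing w u with
  | nil =>
    by_cases hu : u = 1
    · rw [hu, seqSMul_one, mul_one]
    · have hwu : w * u ≠ 1 := by
        intro h1
        rw [LengthAdd, h1, length_one] at h
        exact hu (cs.length_eq_zero_iff.1 (by omega))
      simp [seqSMul, hu, hwu, cs.greatestPrefix_eq_of_lengthAdd h]
  | cons v L ih =>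
    obtain ⟨h1, h2⟩ := cs.greatestPrefix_mul h v
    have h3 := (h2.trans (cs.greatestPrefix_isPrefix u v)).2
    rw [seqSMul, seqSMul, seqSMul, h1, mul_assoc]
    congr 1
    rw [← mul_assoc, mul_inv_rev, inv_mul_cancel_right, ih h3]
    congr 1
    group

theorem length_seqSMul_le (w : W) (L : List W) : (cs.seqSMul w L).length ≤ L.length + 1 := by
  induction L generalizing w with
  | nil =>
    rw [seqSMul]
    split_ifs <;> simp
  | cons v L ih => simpa [seqSMul] using ih _

/-- The action of `w` on sequences, as an element of the monoid of endomaps. -/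
noncomputable def seqEnd (w : W) : Function.End (List W) := cs.seqSMul w

theorem prod_map_seqEnd_simple {ω : List B} (h : cs.IsReduced ω) :
    (ω.map fun i => cs.seqEnd (cs.simple i)).prod = cs.seqEnd (cs.wordProd ω) := by
  induction ω with
  | nil =>
    funext L
    exact (cs.seqSMul_one L).symm
  | cons i ω ih =>
    have hω : cs.IsReduced ω := IsReduced.of_append_right (ω := [i]) cs h
    rw [List.map_cons, List.prod_cons, ih hω]
    funext L
    rw [wordProd_cons]
    refine cs.seqSMul_mul ?_ L
    rw [LengthAdd, ← wordProd_cons, h.eq, hω.eq, length_simple, List.length_cons, add_comm]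

/-- The action of the braid monoid on sequences. -/
noncomputable def braidAction : cs.BraidMonoid →* Function.End (List W) :=
  PresentedMonoid.lift (fun i => cs.seqEnd (cs.simple i)) (by
    rintro _ _ ⟨i, j⟩
    rw [FreeMonoid.lift_apply, FreeMonoid.lift_apply, FreeMonoid.toList_ofList,
      FreeMonoid.toList_ofList, prod_map_seqEnd_simple _ (cs.isReduced_braidSide i j),
      prod_map_seqEnd_simple _ (cs.isReduced_braidSide j i)]
    congr 1
    exact (cs.dihedralLongest_comm i j).symm)

theorem braidAction_posLift (w : W) (L : List W) :
    cs.braidAction (cs.posLift w) L = cs.seqSMul w L := by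
  obtain ⟨ω, hω, rfl⟩ := cs.exists_isReduced w
  rw [hω.posLift_wordProd]
  have h : cs.braidAction (cs.braidMk ω) = cs.seqEnd (cs.wordProd ω) := by
    rw [← cs.prod_map_seqEnd_simple hω]
    exact FreeMonoid.lift_apply _ _
  rw [h, seqEnd]

/-- The product of the positive lifts of the terms of a sequence. -/
noncomputable def seqProd (L : List W) : cs.BraidMonoid := (L.map cs.posLift).prod

theorem seqProd_seqSMul (w : W) (L : List W) :
    cs.seqProd (cs.seqSMul w L) = cs.posLift w * cs.seqProd L := by
  induction L generalizing w with
  | nil =>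
    rw [seqSMul]
    split_ifs with h <;> simp [h, seqProd]
  | cons v L ih =>
    have h1 : cs.posLift v = cs.posLift (cs.greatestPrefix w v) *
        cs.posLift ((cs.greatestPrefix w v)⁻¹ * v) := by
      rw [← posLift_mul _ (cs.greatestPrefix_isPrefix w v), mul_inv_cancel_left]
    simp only [seqProd, seqSMul, List.map_cons, List.prod_cons] at ih ⊢
    rw [ih, posLift_mul _ (cs.lengthAdd_greatestPrefix w v), h1]
    simp only [mul_assoc]

/-! ### Normal forms, left cancellation and right divisors. -/

theorem braidMonoid_induction {P : cs.BraidMonoid → Prop} (one : P 1)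
    (mul : ∀ i a, P a → P (cs.posLift (cs.simple i) * a)) (a : cs.BraidMonoid) : P a := by
  obtain ⟨ω, rfl⟩ := cs.exists_braidMk_eq a
  induction ω with
  | nil => exact one
  | cons i ω ih =>
    have h := mul i _ ih
    rwa [posLift_simple, ← braidMk_append] at h

/-- The normal form of an element of the braid monoid. -/
noncomputable def normalSeq (a : cs.BraidMonoid) : List W := cs.braidAction a []

theorem normalSeq_one : cs.normalSeq 1 = [] := by
  rw [normalSeq, map_one]
  rfl

theorem normalSeq_posLift_mul (w : W) (a : cs.BraidMonoid) :
    cs.normalSeq (cs.posLift w * a) = cs.seqSMul w (cs.normalSeq a) := by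
  rw [normalSeq, map_mul, ← braidAction_posLift]
  rfl

theorem seqProd_normalSeq (a : cs.BraidMonoid) : cs.seqProd (cs.normalSeq a) = a := by
  induction a using cs.braidMonoid_induction with
  | one => simp [normalSeq_one, seqProd]
  | mul i a ih => rw [normalSeq_posLift_mul, seqProd_seqSMul, ih]

/-- A sequence is determined, up to the value of its product, by its image under `w`. -/
theorem seqProd_eq_posLift_mul (w : W) (L : List W) :
    cs.seqProd L = cs.posLift (w⁻¹ * (cs.seqSMul w L).headD 1) *
      cs.seqProd (cs.seqSMul w L).tail := by
  cases L with
  | nil =>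
    rw [seqSMul]
    split_ifs with h <;> simp [h, seqProd]
  | cons v L =>
    simp only [seqSMul, List.headD_cons, List.tail_cons, inv_mul_cancel_left]
    rw [seqProd_seqSMul, ← mul_assoc, ← posLift_mul _ (cs.greatestPrefix_isPrefix w v),
      mul_inv_cancel_left]
    simp [seqProd]

/-- Recovers `a` from the product `posLift w * a` alone, with no more simple factors than the normal
form of that product, or a single trivial factor if that form is empty. -/
theorem eq_posLift_mul_seqProd (w : W) (a : cs.BraidMonoid) :
    a = cs.posLift (w⁻¹ * (cs.normalSeq (cs.posLift w * a)).headD 1) *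
      cs.seqProd (cs.normalSeq (cs.posLift w * a)).tail := by
  conv_lhs => rw [← cs.seqProd_normalSeq a]
  rw [normalSeq_posLift_mul, ← seqProd_eq_posLift_mul]

theorem braidMonoid_mul_left_cancel {a b c : cs.BraidMonoid} (h : a * b = a * c) : b = c := by
  induction a using cs.braidMonoid_induction with
  | one => simpa using h
  | mul i a ih =>
    rw [mul_assoc, mul_assoc] at h
    exact ih (by
      rw [cs.eq_posLift_mul_seqProd (cs.simple i) (a * b), h, ← eq_posLift_mul_seqProd])

/-- A right divisor of a product of two simple elements is a product of two simple elements. -/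
theorem eq_posLift_mul_posLift_of_mul_eq {a b : cs.BraidMonoid} {x y : W}
    (h : a * b = cs.posLift x * cs.posLift y) :
    ∃ x' y', b = cs.posLift x' * cs.posLift y' := by
  induction a using cs.braidMonoid_induction generalizing x y with
  | one => exact ⟨x, y, by simpa using h⟩
  | mul i a ih =>
    rw [mul_assoc] at h
    have h1 := cs.eq_posLift_mul_seqProd (cs.simple i) (a * b)
    -- The normal form of a product of two simple elements has at most two terms.
    have h2 : (cs.normalSeq (cs.posLift (cs.simple i) * (a * b))).tail.length ≤ 1 := by
      rw [h, ← mul_one (cs.posLift y), normalSeq_posLift_mul, normalSeq_posLift_mul,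
        List.length_tail]
      have h3 := cs.length_seqSMul_le x (cs.seqSMul y (cs.normalSeq 1))
      have h4 := cs.length_seqSMul_le y (cs.normalSeq 1)
      have h5 : (cs.normalSeq 1).length = 0 := by simp [normalSeq_one]
      omega
    generalize (cs.normalSeq (cs.posLift (cs.simple i) * (a * b))).tail = L at h1 h2
    generalize (cs.simple i)⁻¹ * _ = c at h1
    match L, h2 with
    | [], _ => exact ih (x := c) (y := 1) (by rw [h1]; simp [seqProd])
    | [z], _ => exact ih (x := c) (y := z) (by rw [h1]; simp [seqProd])

end Action

/-! ### The longest element -/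

section Longest

variable {cs}

theorem IsLongest.inv {w₀ : W} (h : cs.IsLongest w₀) : cs.IsLongest w₀⁻¹ := by
  intro w
  rw [length_inv]
  exact h w

theorem IsLongest.length_mul_inv {w₀ : W} (h : cs.IsLongest w₀) (w : W) :
    cs.length (w₀ * w⁻¹) + cs.length w = cs.length w₀ := by
  obtain ⟨ω, hω, rfl⟩ := cs.exists_isReduced w
  induction ω with
  | nil => simp
  | cons i ω ih =>
    have hω' : cs.IsReduced ω := IsReduced.of_append_right (ω := [i]) cs hω
    have ih := ih hω'
    rw [hω'.eq] at ih
    rw [hω.eq, wordProd_cons, mul_inv_rev, inv_simple, ← mul_assoc, List.length_cons]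
    set w := cs.wordProd ω
    suffices hd : cs.IsRightDescent (w₀ * w⁻¹) i by
      have := cs.isRightDescent_iff.1 hd
      omega
    by_contra hd
    rw [not_isRightDescent_iff] at hd
    obtain ⟨α, hα, e⟩ := cs.exists_isReduced (w₀ * w⁻¹)
    have ht : cs.IsReflection (w⁻¹ * cs.simple i * w) := ⟨w⁻¹, i, by simp⟩
    have h0 : w₀ = cs.wordProd (α ++ ω) := by
      rw [wordProd_append, ← e, inv_mul_cancel_right]
    have hinv : cs.IsRightInversion (cs.wordProd (α ++ ω)) (w⁻¹ * cs.simple i * w) := by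
      rw [← h0]
      exact ⟨ht, lt_of_le_of_ne (h _) (ht.length_mul_left_ne _)⟩
    -- A letter deleted from `α` would make `w₀ * w⁻¹ * s_i` too short; one deleted from `ω` would
    -- make `s_i * w` too short.
    obtain ⟨k, hk, he⟩ := hinv.exists_eraseIdx cs
    rw [← h0] at he
    have hαl := hα.eq
    rw [← e] at hαl
    rcases lt_or_ge k α.length with hkα | hkα
    · rw [List.eraseIdx_append_of_lt_length hkα, wordProd_append, ← mul_assoc, ← mul_assoc] at he
      have h1 := cs.length_wordProd_le (α.eraseIdx k)
      rw [← mul_right_cancel he, hd, List.length_eraseIdx_of_lt hkα] at h1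
      omega
    · rw [List.eraseIdx_append_of_length_le hkα, wordProd_append, ← e, mul_assoc w₀,
        mul_left_cancel_iff, mul_assoc, mul_left_cancel_iff] at he
      have h1 := cs.length_wordProd_le (ω.eraseIdx (k - α.length))
      rw [← he, ← wordProd_cons, hω.eq, List.length_cons] at h1
      have h2 := List.length_eraseIdx_le ω (k - α.length)
      omega

theorem IsLongest.lengthAdd_mul_inv {w₀ : W} (h : cs.IsLongest w₀) (w : W) :
    cs.LengthAdd (w₀ * w⁻¹) w := by
  rw [LengthAdd, h.length_mul_inv, inv_mul_cancel_right]

theorem IsLongest.mul_self {w₀ : W} (h : cs.IsLongest w₀) : w₀ * w₀ = 1 := by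
  have h1 := h.length_mul_inv w₀⁻¹
  rw [inv_inv, length_inv, Nat.add_eq_right, length_eq_zero_iff] at h1
  exact h1

theorem IsLongest.lengthAdd_inv_mul {w₀ : W} (h : cs.IsLongest w₀) (w : W) :
    cs.LengthAdd w (w⁻¹ * w₀) := by
  have h1 := h.inv.length_mul_inv w⁻¹
  rw [← mul_inv_rev, length_inv, length_inv, length_inv] at h1
  rw [LengthAdd, mul_inv_cancel_left, ← h1, add_comm]

variable [Finite W]

theorem IsLongest.posLift_eq_mul {w₀ : W} (h : cs.IsLongest w₀) (w : W) :
    cs.posLift (w₀ * w⁻¹) * cs.posLift w = cs.posLift w₀ := by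
  rw [← posLift_mul _ (h.lengthAdd_mul_inv w), inv_mul_cancel_right]

theorem IsLongest.posLift_mul_eq {w₀ : W} (h : cs.IsLongest w₀) (w : W) :
    cs.posLift w * cs.posLift (w⁻¹ * w₀) = cs.posLift w₀ := by
  rw [← posLift_mul _ (h.lengthAdd_inv_mul w), mul_inv_cancel_left]

/-- `Δ` factors as the lift of `w⁻¹ * w₀` times the lift of `w₀ * w * w₀`, and the first factor
completes `w` to `Δ`. -/
theorem IsLongest.posLift_mul_comm {w₀ : W} (h : cs.IsLongest w₀) (w : W) :
    cs.posLift w * cs.posLift w₀ = cs.posLift w₀ * cs.posLift (w₀ * w * w₀) := by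
  have h0 : w₀⁻¹ = w₀ := inv_eq_of_mul_eq_one_left h.mul_self
  have h1 : w₀ * (w₀ * w * w₀)⁻¹ = w⁻¹ * w₀ := by
    rw [mul_inv_rev, mul_inv_rev, h0, ← mul_assoc, h.mul_self, one_mul]
  have h2 := h.posLift_eq_mul (w₀ * w * w₀)
  rw [h1] at h2
  conv_lhs => rw [← h2]
  rw [← mul_assoc, h.posLift_mul_eq]

theorem IsLongest.posLift_mul_self_comm {w₀ : W} (h : cs.IsLongest w₀) (a : cs.BraidMonoid) :
    a * (cs.posLift w₀ * cs.posLift w₀) = cs.posLift w₀ * cs.posLift w₀ * a := by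
  induction a using cs.braidMonoid_induction with
  | one => simp
  | mul i a ih =>
    have h1 : w₀ * (w₀ * cs.simple i * w₀) * w₀ = cs.simple i := by
      simp only [mul_assoc, h.mul_self, mul_one]
      rw [← mul_assoc, h.mul_self, one_mul]
    rw [mul_assoc, ih, ← mul_assoc, ← mul_assoc, h.posLift_mul_comm, mul_assoc (cs.posLift w₀),
      h.posLift_mul_comm, h1]
    simp only [mul_assoc]

end Longest

/-! ### The braid monoid embeds in the braid group -/

section Embedding

/-- The powers of a central element form an Ore set. -/
@[reducible]
def oreSetPowersOfCentral {R : Type*} [Monoid R] (z : R) (hz : ∀ a, a * z = z * a) :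
    OreLocalization.OreSet (Submonoid.powers z) :=
  have hc : ∀ (s : Submonoid.powers z) (a : R), s * a = a * s := by
    rintro ⟨_, n, rfl⟩ a
    exact ((show Commute a z from hz a).pow_right n).symm.eq
  { ore_right_cancel := fun r₁ r₂ s h => ⟨s, by rw [hc, hc, h]⟩
    oreNum := fun r _ => r
    oreDenom := fun _ s => s
    ore_eq := fun r s => hc s r }

theorem braidMonoidHom_braidMk (ω : List B) :
    cs.braidMonoidHom (cs.braidMk ω) = cs.braidProd ω :=
  FreeMonoid.lift_apply _ _

theorem braidMonoidHom_injective [Finite W] : Function.Injective cs.braidMonoidHom := by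
  obtain ⟨w₀, h⟩ : ∃ w₀, cs.IsLongest w₀ := Finite.exists_max cs.length
  set z := cs.posLift w₀ * cs.posLift w₀ with hz
  let _ := oreSetPowersOfCentral z h.posLift_mul_self_comm
  let S := Submonoid.powers z
  let E := OreLocalization S cs.BraidMonoid
  let η : cs.BraidMonoid →* E := OreLocalization.numeratorHom
  have hη : Function.Injective η := by
    intro a b hab
    obtain ⟨u, v, h1, h2⟩ := OreLocalization.oreDiv_eq_iff.1 hab
    simp only [Submonoid.coe_one, mul_one] at h2
    have h3 : (u : cs.BraidMonoid) * b = v * a := h1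
    rw [← h2] at h3
    exact (cs.braidMonoid_mul_left_cancel h3).symm
  have hunit : ∀ i, IsUnit (η (cs.braidMk [i])) := by
    intro i
    obtain ⟨ζ, hζ⟩ : IsUnit (η z) :=
      OreLocalization.numerator_isUnit (⟨z, Submonoid.mem_powers z⟩ : S)
    rw [isUnit_iff_exists_and_exists, ← posLift_simple]
    -- A generator divides `Δ`, hence `Δ²`, on both sides; the cofactors divided by `Δ²` are its
    -- one-sided inverses.
    refine ⟨⟨η (cs.posLift ((cs.simple i)⁻¹ * w₀) * cs.posLift w₀) * ↑ζ⁻¹, ?_⟩,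
      ⟨↑ζ⁻¹ * η (cs.posLift w₀ * cs.posLift (w₀ * (cs.simple i)⁻¹)), ?_⟩⟩
    · rw [← mul_assoc, ← map_mul, ← mul_assoc, h.posLift_mul_eq, ← hz, ← hζ, Units.mul_inv]
    · rw [mul_assoc, ← map_mul, mul_assoc, h.posLift_eq_mul, ← hz, ← hζ, Units.inv_mul]
  let f : B → Eˣ := fun i => (hunit i).unit
  have hf : ∀ ω : List B,
      ((FreeGroup.lift f (ω.map FreeGroup.of).prod : Eˣ) : E) = η (cs.braidMk ω) := by
    intro ω
    induction ω with
    | nil => simp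
    | cons i ω ih =>
      rw [List.map_cons, List.prod_cons, map_mul, Units.val_mul, ih, FreeGroup.lift_apply_of]
      exact (map_mul η (cs.braidMk [i]) (cs.braidMk ω)).symm
  have hrel : ∀ r ∈ cs.braidRelators, FreeGroup.lift f r = 1 := by
    rintro _ ⟨⟨i, j⟩, rfl⟩
    rw [map_mul, map_inv, mul_inv_eq_one, Units.ext_iff, hf, hf, braidMk_braidSide]
  let g : cs.BraidGroup →* Eˣ := PresentedGroup.toGroup hrel
  have hg : ∀ ω : List B, ((g (cs.braidProd ω) : Eˣ) : E) = η (cs.braidMk ω) := by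
    intro ω
    rw [← hf, braidProd, map_list_prod, map_list_prod, List.map_map, List.map_map]
    congr 3
  intro a b hab
  obtain ⟨ω, rfl⟩ := cs.exists_braidMk_eq a
  obtain ⟨ω', rfl⟩ := cs.exists_braidMk_eq b
  rw [braidMonoidHom_braidMk, braidMonoidHom_braidMk] at hab
  exact hη (by rw [← hg, ← hg, hab])

end Embedding

/-! ### Simple braids -/

section SimpleBraids

theorem mem_rationalPermutationBraids_iff {Δ β : cs.BraidGroup} :
    β ∈ cs.rationalPermutationBraids Δ ↔
      Δ * β ∈ cs.positiveBraids ∧ β⁻¹ * Δ ∈ cs.positiveBraids := by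
  change (Δ⁻¹)⁻¹ * β ∈ cs.positiveBraids ∧ β⁻¹ * Δ ∈ cs.positiveBraids ↔ _
  rw [inv_inv]

/-- The positive lift of an element of `W` to the braid group. -/
noncomputable def simpleBraid (w : W) : cs.BraidGroup := cs.braidMonoidHom (cs.posLift w)

theorem simpleBraid_mem_positiveBraids (w : W) : cs.simpleBraid w ∈ cs.positiveBraids :=
  ⟨_, rfl⟩

variable [Finite W]

theorem isPositiveLift_iff {β : cs.BraidGroup} {w : W} :
    cs.IsPositiveLift β w ↔ β = cs.simpleBraid w := by
  constructor
  · rintro ⟨ω, hω, rfl, rfl⟩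
    rw [simpleBraid, hω.posLift_wordProd, braidMonoidHom_braidMk]
  · rintro rfl
    obtain ⟨ω, hω, rfl⟩ := cs.exists_isReduced w
    exact ⟨ω, hω, rfl, by rw [simpleBraid, hω.posLift_wordProd, braidMonoidHom_braidMk]⟩

theorem mem_simpleBraids_iff {β : cs.BraidGroup} :
    β ∈ cs.simpleBraids ↔ ∃ w, β = cs.simpleBraid w := by
  simp only [simpleBraids, Set.mem_ofPred_eq, isPositiveLift_iff]

variable {cs}

theorem IsLongest.simpleBraid_mul_inv {w₀ : W} (h : cs.IsLongest w₀) (w : W) :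
    cs.simpleBraid w₀ * (cs.simpleBraid w)⁻¹ = cs.simpleBraid (w₀ * w⁻¹) := by
  rw [mul_inv_eq_iff_eq_mul, simpleBraid, simpleBraid, simpleBraid, ← map_mul, h.posLift_eq_mul]

theorem IsLongest.simpleBraid_inv_mul {w₀ : W} (h : cs.IsLongest w₀) (w : W) :
    (cs.simpleBraid w)⁻¹ * cs.simpleBraid w₀ = cs.simpleBraid (w⁻¹ * w₀) := by
  rw [inv_mul_eq_iff_eq_mul, simpleBraid, simpleBraid, simpleBraid, ← map_mul, h.posLift_mul_eq]

theorem IsLongest.simpleBraid_mul_comm {w₀ : W} (h : cs.IsLongest w₀) (w : W) :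
    cs.simpleBraid w * cs.simpleBraid w₀ = cs.simpleBraid w₀ * cs.simpleBraid (w₀ * w * w₀) := by
  rw [simpleBraid, simpleBraid, simpleBraid, ← map_mul, ← map_mul, h.posLift_mul_comm]

theorem IsLongest.exists_mul_inv_of_mem {w₀ : W} (h : cs.IsLongest w₀) {β : cs.BraidGroup}
    (hβ : β ∈ cs.rationalPermutationBraids (cs.simpleBraid w₀)) :
    ∃ x y, β = cs.simpleBraid x * (cs.simpleBraid y)⁻¹ := by
  obtain ⟨⟨a, ha⟩, ⟨b, hb⟩⟩ := cs.mem_rationalPermutationBraids_iff.1 hβ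
  have hab : a * b = cs.posLift w₀ * cs.posLift w₀ := by
    apply cs.braidMonoidHom_injective
    rw [map_mul, map_mul, ha, hb, mul_assoc, mul_inv_cancel_left]
    rfl
  obtain ⟨x, y, rfl⟩ := cs.eq_posLift_mul_posLift_of_mul_eq hab
  refine ⟨w₀ * y⁻¹, x, ?_⟩
  rw [map_mul] at hb
  change cs.simpleBraid x * cs.simpleBraid y = _ at hb
  rw [← h.simpleBraid_mul_inv, mul_assoc, ← mul_inv_rev, hb]
  group

/-- With `x̃` the lift of `w₀ * x * w₀`, one has `x = Δ⁻¹x̃Δ`, so `xy⁻¹ = (x̃⁻¹Δ)⁻¹(Δy⁻¹)`, and both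
brackets are simple. -/
theorem IsLongest.exists_inv_mul_of_mul_inv {w₀ : W} (h : cs.IsLongest w₀) (x y : W) :
    ∃ x' y', cs.simpleBraid x * (cs.simpleBraid y)⁻¹ =
      (cs.simpleBraid x')⁻¹ * cs.simpleBraid y' := by
  have h0 : w₀ * (w₀ * x * w₀) * w₀ = x := by
    simp only [mul_assoc, h.mul_self, mul_one]
    rw [← mul_assoc, h.mul_self, one_mul]
  have h1 := h.simpleBraid_mul_comm (w₀ * x * w₀)
  rw [h0] at h1
  refine ⟨(w₀ * x * w₀)⁻¹ * w₀, w₀ * y⁻¹, ?_⟩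
  rw [← h.simpleBraid_inv_mul, ← h.simpleBraid_mul_inv, mul_inv_rev, inv_inv, mul_assoc,
    ← mul_assoc (cs.simpleBraid (w₀ * x * w₀)), h1]
  group

theorem IsLongest.inv_mul_mem {w₀ : W} (h : cs.IsLongest w₀) (x y : W) :
    (cs.simpleBraid x)⁻¹ * cs.simpleBraid y ∈
      cs.rationalPermutationBraids (cs.simpleBraid w₀) := by
  rw [mem_rationalPermutationBraids_iff]
  constructor
  · rw [← mul_assoc, h.simpleBraid_mul_inv]
    exact mul_mem (cs.simpleBraid_mem_positiveBraids _) (cs.simpleBraid_mem_positiveBraids _)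
  · rw [mul_inv_rev, inv_inv, mul_assoc, h.simpleBraid_mul_comm, ← mul_assoc,
      h.simpleBraid_inv_mul]
    exact mul_mem (cs.simpleBraid_mem_positiveBraids _) (cs.simpleBraid_mem_positiveBraids _)

end SimpleBraids

end CoxeterSystem

theorem mainTheorem8 {B W : Type*} [Group W] [Finite W] {M : CoxeterMatrix B}
    (cs : CoxeterSystem M W) (Δ : cs.BraidGroup) (hΔ : cs.IsGarsideElement Δ)
    (β : cs.BraidGroup) :
    (β ∈ cs.rationalPermutationBraids Δ ↔
      ∃ x ∈ cs.simpleBraids, ∃ y ∈ cs.simpleBraids, β = x⁻¹ * y) ∧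
    (β ∈ cs.rationalPermutationBraids Δ ↔
      ∃ x ∈ cs.simpleBraids, ∃ y ∈ cs.simpleBraids, β = x * y⁻¹) := by
  obtain ⟨w₀, h, hlift⟩ := hΔ
  obtain rfl := cs.isPositiveLift_iff.1 hlift
  have hmem : ∀ w, cs.simpleBraid w ∈ cs.simpleBraids := fun w =>
    cs.mem_simpleBraids_iff.2 ⟨w, rfl⟩
  refine ⟨⟨fun hβ => ?_, ?_⟩, ⟨fun hβ => ?_, ?_⟩⟩
  · obtain ⟨x, y, rfl⟩ := h.exists_mul_inv_of_mem hβ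
    obtain ⟨x', y', e⟩ := h.exists_inv_mul_of_mul_inv x y
    exact ⟨_, hmem x', _, hmem y', e⟩
  · rintro ⟨_, hx, _, hy, rfl⟩
    obtain ⟨x, rfl⟩ := cs.mem_simpleBraids_iff.1 hx
    obtain ⟨y, rfl⟩ := cs.mem_simpleBraids_iff.1 hy
    exact h.inv_mul_mem x y
  · obtain ⟨x, y, rfl⟩ := h.exists_mul_inv_of_mem hβ
    exact ⟨_, hmem x, _, hmem y, rfl⟩
  · rintro ⟨_, hx, _, hy, rfl⟩
    obtain ⟨x, rfl⟩ := cs.mem_simpleBraids_iff.1 hx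
    obtain ⟨y, rfl⟩ := cs.mem_simpleBraids_iff.1 hy
    obtain ⟨x', y', e⟩ := h.exists_inv_mul_of_mul_inv x y
    rw [e]
    exact h.inv_mul_mem x' y'
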